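/- Let $\mathcal X$ be a measurable space, $\mathcal Y$ a finite label set (with all subsets measurable), and $\mathcal D$ a probability distribution on $\mathcal X\times\mathcal Y$ with marginal $\mathcal D_{\mathcal X}$ on $\mathcal X$ and conditional probabilities $p(x,y)=\mathcal D(Y=y\mid X=x)$ (any version for which $x\mapsto p(x,y)$ is measurable and $p(x,\cdot)$ is a probability vector for every $x$). Consider either of two settings. (a) Multi-class: $\mathcal H_{\rm all}$ is the family of all measurable $h\colon\mathcal X\times\mathcal Y\to\mathbb R$, one writes $h(x)=(h(x,y'))_{y'\in\mathcal Y}$, and a loss $\ell(h,x,y)\in[0,\infty)$ is *pointwise* if there is a measurable $\hat\ell\colon\mathbb R^{\mathcal Y}\times\mathcal Y\to[0,\infty)$ with $\ell(h,x,y)=\hat\ell(h(x),y)$ for all $h\in\mathcal H_{\rm all}$, $x\in\mathcal X$, $y\in\mathcal Y$. (b) Binary (single score; typically $\mathcal Y=\{-1,+1\}$): $\mathcal H_{\rm all}$ is the family of all measurable $h\colon\mathcal X\to\mathbb R$, and $\ell$ is *pointwise* if there is a measurable $\hat\ell\colon\mathbb R\times\mathcal Y\to[0,\infty)$ with $\ell(h,x,y)=\hat\ell(h(x),y)$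 for all $h\in\mathcal H_{\rm all}$, $x\in\mathcal X$, $y\in\mathcal Y$. For $\mathcal H\subseteq\mathcal H_{\rm all}$ put, with values in $[0,\infty]$, $$\mathcal E_\ell(h)=\mathbb E_{(x,y)\sim\mathcal D}[\ell(h,x,y)],\qquad \mathcal E^*_\ell(\mathcal H)=\inf_{h\in\mathcal H}\mathcal E_\ell(h),$$ $$\mathcal C_\ell(h,x)=\sum_{y\in\mathcal Y}p(x,y)\,\ell(h,x,y),\qquad \mathcal C^*_\ell(\mathcal H,x)=\inf_{h\in\mathcal H}\mathcal C_\ell(h,x),$$ and let $\mathcal A_\ell(\mathcal H)=\mathcal E^*_\ell(\mathcal H)-\mathcal E^*_\ell(\mathcal H_{\rm all})$ be the approximation error (a difference of extended reals, with any fixed convention for $\infty-\infty$). Lemma. If $\ell$ is a pointwise loss, then $x\mapsto\mathcal C^*_\ell(\mathcal H_{\rm all},x)$ is measurable, the Bayes error satisfies $$\mathcal E^*_\ell(\mathcal H_{\rm all})=\mathbb E_{x\sim\mathcal D_{\mathcal X}}\big[\mathcal C^*_\ell(\mathcal H_{\rm all},x)\big],$$ and, for every $\mathcal H\subseteq\mathcal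 H_{\rm all}$, $$\mathcal A_\ell(\mathcal H)=\mathcal E^*_\ell(\mathcal H)-\mathbb E_{x\sim\mathcal D_{\mathcal X}}\big[\mathcal C^*_\ell(\mathcal H_{\rm all},x)\big].$$ -/

import Mathlib

open MeasureTheory ProbabilityTheory
open scoped NNReal ENNReal

namespace Learning

/-- The family of all measurable real-valued predictors on `Z`. In multi-class classification
`Z = X × Y` (one score per label); in binary classification `Z = X` (one single score). -/
def Hall (Z : Type*) [MeasurableSpace Z] : Set (Z → ℝ) := {h | Measurable h}

/-- A loss function `ℓ (h, x, y) ≥ 0`, for predictors `h : Z → ℝ`. Only its values at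
measurable predictors matter below. -/
abbrev Loss (Z X Y : Type*) := (Z → ℝ) → X → Y → ℝ≥0

variable {Z X Y : Type*} [MeasurableSpace Z] [MeasurableSpace X] [MeasurableSpace Y]

/-- Pointwise loss, multi-class convention: `ℓ (h, x, y)` is a measurable function of the score
vector `(h (x, y'))_{y'}` and of the label `y`. -/
def IsPointwiseMulticlass (ℓ : Loss (X × Y) X Y) : Prop :=
  ∃ lhat : (Y → ℝ) × Y → ℝ≥0, Measurable lhat ∧
    ∀ h ∈ Hall (X × Y), ∀ x y, ℓ h x y = lhat (fun y' => h (x, y'), y)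

/-- Pointwise loss, binary convention: `ℓ (h, x, y)` is a measurable function of the single score
`h x` and of the label `y`. -/
def IsPointwiseBinary (ℓ : Loss X X Y) : Prop :=
  ∃ lhat : ℝ × Y → ℝ≥0, Measurable lhat ∧
    ∀ h ∈ Hall X, ∀ x y, ℓ h x y = lhat (h x, y)

/-- Generalization error: the expectation of `ℓ (h, x, y)` for `(x, y)` drawn from `D`,
with value `∞` allowed. -/
noncomputable def genError (D : Measure (X × Y)) (ℓ : Loss Z X Y) (h : Z → ℝ) : ℝ≥0∞ :=
  ∫⁻ z, (ℓ h z.1 z.2 : ℝ≥0∞) ∂D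

/-- Best-in-class error over the hypothesis set `H`. -/
noncomputable def bestError (D : Measure (X × Y)) (ℓ : Loss Z X Y) (H : Set (Z → ℝ)) : ℝ≥0∞ :=
  ⨅ h ∈ H, genError D ℓ h

/-- Bayes error. -/
noncomputable def bayesError (D : Measure (X × Y)) (ℓ : Loss Z X Y) : ℝ≥0∞ :=
  bestError D ℓ (Hall Z)

/-- Approximation error of `H`, as a difference of extended reals (so without truncation). -/
noncomputable def approxError (D : Measure (X × Y)) (ℓ : Loss Z X Y) (H : Set (Z → ℝ)) : EReal :=
  (bestError D ℓ H : EReal) - (bayesError D ℓ : EReal)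

/-- Conditional error of `h` at `x`, where `κ x {y}` is the conditional probability of the
label `y` given `x`. -/
noncomputable def condError [Fintype Y] (κ : Kernel X Y) (ℓ : Loss Z X Y) (h : Z → ℝ) (x : X) :
    ℝ≥0∞ :=
  ∑ y, κ x {y} * (ℓ h x y : ℝ≥0∞)

/-- Best-in-class conditional error of the hypothesis set `H` at `x`. -/
noncomputable def bestCondError [Fintype Y] (κ : Kernel X Y) (ℓ : Loss Z X Y) (H : Set (Z → ℝ))
    (x : X) : ℝ≥0∞ :=
  ⨅ h ∈ H, condError κ ℓ h x

end Learning

/-!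
The conditional error of a score `v` at `x` depends on `x` only through the probability vector
`p x = (κ x {y})_y`, and for fixed `v` it is the continuous function `p ↦ ∑ y, p y * lhat (v, y)`,
because the losses are finite. An infimum of continuous functions on a second-countable space is
already the infimum of a countable subfamily (Lindelöf, `exists_seq_iInf_sum_mul_eq`). Hence there is
one sequence of scores whose conditional errors have, at every `x`, the same infimum as the errors
of all scores. The best conditional error is therefore measurable, and choosing at each `x` the
first score in the sequence that is `ε`-optimal gives a measurable predictor which is `ε`-optimal at
every `x` simultaneously (`exists_measurable_sum_mul_le`). Integrating the conditional error and
letting `ε → 0` gives the Bayes error.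

Both conventions for predictors are instances of one situation: an evaluation map
`ev : (Z → ℝ) → X → V` into a score space `V` which sends measurable predictors to measurable
functions and reaches every measurable function `X → V`. For the multi-class convention
`V = Y → ℝ`, for the binary one `V = ℝ`.
-/

namespace Learning

/-- Among the continuous functions `p ↦ ∑ y, p y * c v y`, `v : V`,
countably many have the same infimum as all of them, at every `p` simultaneously. No measurability
of `c` in `v` is involved. -/
lemma exists_seq_iInf_sum_mul_eq {V Y : Type*} [Nonempty V] [Fintype Y] (c : V → Y → ℝ≥0) :
    ∃ u : ℕ → V, ∀ p : Y → ℝ≥0∞,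
      ⨅ n, ∑ y, p y * (c (u n) y : ℝ≥0∞) = ⨅ v, ∑ y, p y * (c v y : ℝ≥0∞) := by
  let F : V → (Y → ℝ≥0∞) → ℝ≥0∞ := fun v p => ∑ y, p y * (c v y : ℝ≥0∞)
  have hF (v : V) : Continuous (F v) :=
    continuous_finsetSum _ fun y _ =>
      (ENNReal.continuous_mul_const ENNReal.coe_ne_top).comp (continuous_apply y)
  obtain ⟨G, hGF, hGc, hG⟩ := exists_countable_upperSemicontinuous_isGLB (𝓕 := Set.range F)
    (by rintro _ ⟨v, rfl⟩; exact (hF v).upperSemicontinuous) (isGLB_iInf (f := F))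
  have hne : G.Nonempty := by
    -- The empty family has infimum `⊤`, whereas every member of the full family vanishes at `0`.
    rw [Set.nonempty_iff_ne_empty]
    rintro rfl
    have h0 := congrFun (hG.unique isGLB_empty) 0
    simp [F] at h0
  obtain ⟨f, rfl⟩ := hGc.exists_eq_range hne
  choose u hu using fun n => hGF (Set.mem_range_self n)
  refine ⟨u, fun p => ?_⟩
  have h := congrFun (isGLB_iInf.unique hG) p
  rw [iInf_apply, iInf_apply] at h
  simp only [← hu] at h
  exact h

/-- The pointwise infimum over all scores is measurable, and it is reached up to `ε` by a measurable
choice of scores. -/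
lemma exists_measurable_sum_mul_le {X V Y : Type*} [MeasurableSpace X] [MeasurableSpace V]
    [Nonempty V] [Fintype Y] (c : V → Y → ℝ≥0) {p : X → Y → ℝ≥0∞}
    (hp : ∀ y, Measurable fun x => p x y) (hp_top : ∀ x y, p x y ≠ ∞) :
    Measurable (fun x => ⨅ v, ∑ y, p x y * (c v y : ℝ≥0∞)) ∧
      ∀ ε : ℝ≥0∞, ε ≠ 0 → ∃ g : X → V, Measurable g ∧ ∀ x,
        ∑ y, p x y * (c (g x) y : ℝ≥0∞) ≤ (⨅ v, ∑ y, p x y * (c v y : ℝ≥0∞)) + ε := by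
  classical
  obtain ⟨u, hu⟩ := exists_seq_iInf_sum_mul_eq c
  have hm (v : V) : Measurable fun x => ∑ y, p x y * (c v y : ℝ≥0∞) :=
    Finset.measurable_fun_sum _ fun y _ => (hp y).mul_const _
  have hinf : Measurable fun x => ⨅ v, ∑ y, p x y * (c v y : ℝ≥0∞) := by
    simp only [← hu]
    exact Measurable.iInf fun n => hm (u n)
  refine ⟨hinf, fun ε hε => ?_⟩
  have hex (x : X) : ∃ n, ∑ y, p x y * (c (u n) y : ℝ≥0∞)
      ≤ (⨅ v, ∑ y, p x y * (c v y : ℝ≥0∞)) + ε := by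
    -- Finiteness of the infimum is what makes adding `ε` a strict increase.
    have hfin : (⨅ v, ∑ y, p x y * (c v y : ℝ≥0∞)) ≠ ∞ :=
      ne_top_of_le_ne_top
        (ENNReal.sum_ne_top.2 fun y _ => ENNReal.mul_ne_top (hp_top x y) ENNReal.coe_ne_top)
        (iInf_le _ (u 0))
    have hlt := ENNReal.lt_add_right hfin hε
    nth_rw 1 [← hu] at hlt
    obtain ⟨n, hn⟩ := iInf_lt_iff.1 hlt
    exact ⟨n, hn.le⟩
  exact ⟨fun x => u (Nat.find (hex x)),
    Measurable.find (f := fun n _ => u n) (fun _ => measurable_const)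
      (fun n => measurableSet_le (hm (u n)) (hinf.add_const ε)) hex,
    fun x => Nat.find_spec (hex x)⟩

section ScoreSpace

variable {X Y Z V : Type*} [MeasurableSpace X] [Fintype Y] [MeasurableSpace Y]
  [MeasurableSpace Z] [MeasurableSpace V] {D : Measure (X × Y)} {κ : Kernel X Y}
  {ℓ : Loss Z X Y} {ev : (Z → ℝ) → X → V} {lhat : V × Y → ℝ≥0}

/-- Disintegration of the generalization error along the input. -/
lemma genError_eq_lintegral_condError [MeasurableSingletonClass Y] [IsFiniteMeasure D]
    [IsMarkovKernel κ] [D.IsCondKernel κ]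
    (hlhat : Measurable lhat) (hev : ∀ h ∈ Hall Z, Measurable (ev h))
    (hℓ : ∀ h ∈ Hall Z, ∀ x y, ℓ h x y = lhat (ev h x, y)) {h : Z → ℝ} (hh : h ∈ Hall Z) :
    genError D ℓ h = ∫⁻ x, condError κ ℓ h x ∂D.fst := by
  have hm : Measurable fun z : X × Y => (ℓ h z.1 z.2 : ℝ≥0∞) := by
    simp only [hℓ h hh]
    exact (hlhat.comp (((hev h hh).comp measurable_fst).prodMk measurable_snd)).coe_nnreal_ennreal
  unfold genError
  conv_lhs => rw [← D.disintegrate κ]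
  rw [Measure.lintegral_compProd hm]
  simp only [lintegral_fintype, condError, mul_comm]

variable (κ) in
/-- Any score is the value at `x` of a measurable predictor, for instance of one with constant
score, so the best conditional error is an infimum over scores. -/
lemma bestCondError_eq_iInf_score (hsurj : ∀ g : X → V, Measurable g → ∃ h ∈ Hall Z, ev h = g)
    (hℓ : ∀ h ∈ Hall Z, ∀ x y, ℓ h x y = lhat (ev h x, y)) (x : X) :
    bestCondError κ ℓ (Hall Z) x = ⨅ v, ∑ y, κ x {y} * (lhat (v, y) : ℝ≥0∞) := by
  refine le_antisymm (le_iInf fun v => ?_) (le_iInf₂ fun h hh => ?_)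
  · obtain ⟨h, hh, hv⟩ := hsurj (fun _ => v) measurable_const
    refine (iInf₂_le h hh).trans_eq ?_
    simp only [condError, hℓ h hh, hv]
  · refine (iInf_le _ (ev h x)).trans_eq ?_
    simp only [condError, hℓ h hh]

/-- The Bayes error formula for predictors that are read through an evaluation map into a score
space. -/
theorem bayesError_eq_lintegral_of_score [Nonempty V] [MeasurableSingletonClass Y]
    [IsProbabilityMeasure D] [IsMarkovKernel κ] [D.IsCondKernel κ] (hlhat : Measurable lhat)
    (hev : ∀ h ∈ Hall Z, Measurable (ev h))
    (hsurj : ∀ g : X → V, Measurable g → ∃ h ∈ Hall Z, ev h = g)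
    (hℓ : ∀ h ∈ Hall Z, ∀ x y, ℓ h x y = lhat (ev h x, y)) :
    Measurable (fun x => bestCondError κ ℓ (Hall Z) x) ∧
      bayesError D ℓ = ∫⁻ x, bestCondError κ ℓ (Hall Z) x ∂D.fst := by
  obtain ⟨hmeas, hsel⟩ := exists_measurable_sum_mul_le (fun v y => lhat (v, y))
    (p := fun x y => κ x {y}) (fun y => κ.measurable_coe (measurableSet_singleton y))
    (fun x y => measure_ne_top _ _)
  simp only [← bestCondError_eq_iInf_score κ hsurj hℓ] at hmeas hsel
  refine ⟨hmeas, le_antisymm ?_ (le_iInf₂ fun h hh => ?_)⟩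
  · refine ENNReal.le_of_forall_pos_le_add fun ε hε _ => ?_
    obtain ⟨g, hg, hgle⟩ := hsel ε (ENNReal.coe_ne_zero.2 hε.ne')
    obtain ⟨h, hh, rfl⟩ := hsurj g hg
    calc bayesError D ℓ ≤ genError D ℓ h := iInf₂_le h hh
      _ = ∫⁻ x, condError κ ℓ h x ∂D.fst := genError_eq_lintegral_condError hlhat hev hℓ hh
      _ ≤ ∫⁻ x, (bestCondError κ ℓ (Hall Z) x + ε) ∂D.fst := by
          refine lintegral_mono fun x => ?_
          simpa only [condError, hℓ h hh] using hgle x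
      _ = ∫⁻ x, bestCondError κ ℓ (Hall Z) x ∂D.fst + ε := by
          rw [lintegral_add_right _ measurable_const, lintegral_const, measure_univ, mul_one]
  · rw [genError_eq_lintegral_condError (κ := κ) hlhat hev hℓ hh]
    exact lintegral_mono fun x => iInf₂_le h hh

end ScoreSpace

end Learning

/-- `D` is the distribution on `X × Y`, `D.fst` its marginal on `X`, and `κ` is any version of the
conditional distribution of the label given the input (Mathlib's `D.condKernel` is one). The first
half is the multi-class convention (predictors `X × Y → ℝ`), the second half the binary one
(predictors `X → ℝ`), where `Y` may be any finite label set, in particular one with two labels. -/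
theorem lemma2p1 {X Y : Type*} [MeasurableSpace X] [Fintype Y] [MeasurableSpace Y]
    [MeasurableSingletonClass Y] (D : Measure (X × Y)) [IsProbabilityMeasure D]
    (κ : Kernel X Y) [IsMarkovKernel κ] [D.IsCondKernel κ] :
    (∀ ℓ : Learning.Loss (X × Y) X Y, Learning.IsPointwiseMulticlass ℓ →
      Measurable (fun x => Learning.bestCondError κ ℓ (Learning.Hall (X × Y)) x) ∧
      Learning.bayesError D ℓ
        = ∫⁻ x, Learning.bestCondError κ ℓ (Learning.Hall (X × Y)) x ∂D.fst ∧
      ∀ H ⊆ Learning.Hall (X × Y),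
        Learning.approxError D ℓ H = (Learning.bestError D ℓ H : EReal)
          - ((∫⁻ x, Learning.bestCondError κ ℓ (Learning.Hall (X × Y)) x ∂D.fst : ℝ≥0∞) : EReal)) ∧
    (∀ ℓ : Learning.Loss X X Y, Learning.IsPointwiseBinary ℓ →
      Measurable (fun x => Learning.bestCondError κ ℓ (Learning.Hall X) x) ∧
      Learning.bayesError D ℓ
        = ∫⁻ x, Learning.bestCondError κ ℓ (Learning.Hall X) x ∂D.fst ∧
      ∀ H ⊆ Learning.Hall X,
        Learning.approxError D ℓ H = (Learning.bestError D ℓ H : EReal)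
          - ((∫⁻ x, Learning.bestCondError κ ℓ (Learning.Hall X) x ∂D.fst : ℝ≥0∞) : EReal)) := by
  refine ⟨fun ℓ ⟨lhat, hlhat, hℓ⟩ => ?_, fun ℓ ⟨lhat, hlhat, hℓ⟩ => ?_⟩
  · obtain ⟨hmeas, hbayes⟩ := Learning.bayesError_eq_lintegral_of_score (D := D) (κ := κ)
      (ev := fun h x y' => h (x, y')) hlhat
      (fun h hh => measurable_pi_lambda _ fun y' =>
        Measurable.comp (show Measurable h from hh) measurable_prodMk_right)
      (fun g hg => ⟨fun z => g z.1 z.2,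
        measurable_from_prod_countable_left fun y => (measurable_pi_apply y).comp hg, rfl⟩) hℓ
    exact ⟨hmeas, hbayes, fun H _ => by rw [Learning.approxError, hbayes]⟩
  · obtain ⟨hmeas, hbayes⟩ := Learning.bayesError_eq_lintegral_of_score (D := D) (κ := κ)
      (ev := fun h => h) hlhat (fun _ hh => hh) (fun g hg => ⟨g, hg, rfl⟩) hℓ
    exact ⟨hmeas, hbayes, fun H _ => by rw [Learning.approxError, hbayes]⟩
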